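/- **Game $\mathscr G$.** Two teams $i=1,2$, with players $j=1,\dots,N_i$, interact at times $t=1,\dots,T$. All spaces below are finite. The state satisfies $X_{t+1}=f_t(X_t,U_t^1,U_t^2,W_t^s)$, where $U_t^i=(U_t^{i,1},\dots,U_t^{i,N_i})$ is Team $i$'s action, with $U_t^{i,j}\in\mathcal U_t^{i,j}\neq\varnothing$. Player $(i,j)$'s observation is $Y_t^{i,j}=h_t^{i,j}(X_t,U_{t-1}^1,U_{t-1}^2,W_t^{i,j})$ (without the actions when $t=1$). The primitive variables $X_1,W_t^s,W_t^{i,j}$ are mutually independent. At time $t$ all players know the common information $C_t=(Z_1,\dots,Z_t)$, and Player $(i,j)$ also knows its private information $P_t^{i,j}\in\mathcal P_t^{i,j}$. The variables $Z_1,P_1^{i,j}$ are fixed functions of $Y_1^{1:2}$, and $$Z_{t+1}=\zeta_{t+1}(P_t^{1:2},U_t^{1:2},Y_{t+1}^{1:2}),\qquad P_{t+1}^{i}=\xi_{t+1}^{i}(P_t^{1:2},U_t^{1:2},Y_{t+1}^{1:2})$$ for fixed maps $\zeta_{t+1},\xi^i_{t+1}$. A strategy $g^i\in\mathcal G^i$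 of Team $i$ consists of control laws $g_t^{i,j}:(C_t,P_t^{i,j})\mapsto\delta U_t^{i,j}\in\Delta\,\mathcal U_t^{i,j}$; the actions $U_t^{i,j}$ are drawn from the distributions $\delta U_t^{i,j}$ with independent randomization across players and times. The cost is $J(g^1,g^2)=\mathbb E^{(g^1,g^2)}\big[\sum_{t=1}^T c_t(X_t,U_t^1,U_t^2)\big]$, and $S^u(\mathscr G)=\min_{g^1}\max_{g^2}J(g^1,g^2)$. **Expanded game $\mathscr G_e$.** At time $t$ virtual player $i$ chooses a prescription $\Gamma_t^i=(\Gamma_t^{i,j})_j\in\mathcal B_t^i$, $\Gamma_t^{i,j}:\mathcal P_t^{i,j}\to\Delta\,\mathcal U_t^{i,j}$, by a control law $\Gamma_t^i=\tilde\chi_t^i(C_t,\Gamma_{1:t-1}^{1:2})$. Then the $U_t^{i,j}$ are drawn independently from $\Gamma_t^{i,j}(P_t^{i,j})$, and the system evolves and costs accrue as in $\mathscr G$, with total expected cost $\mathcal J(\tilde\chi^1,\tilde\chi^2)$. Let $S^u(\mathscr G_e)=\inf_{\tilde\chi^1}\sup_{\tilde\chi^2}\mathcal J(\tilde\chi^1,\tilde\chi^2)$.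 The common information belief is $\Pi_t(x,p)=\mathbb P[X_t=x,P_t^{1:2}=p\mid C_t,\Gamma_{1:t-1}^{1:2}]$; $\Pi_1$ does not depend on the strategies. **Dynamic program.** For a belief $\pi$ on $(X_t,P_t^{1:2})$ and prescriptions $\gamma^1,\gamma^2$, let $\tilde c_t(\pi,\gamma^1,\gamma^2)$ be the expected value of $c_t(X_t,U^1_t,U^2_t)$, and $\mathscr P^m_t(\pi,\gamma^1,\gamma^2;z)$ the probability that $Z_{t+1}=z$, when $(X_t,P_t^{1:2})\sim\pi$ and $\gamma^1,\gamma^2$ are used at time $t$. Given a belief update $\Phi_t(\pi,\gamma^1,\gamma^2,z)$, put $V^u_{T+1}=0$ and, for $t\le T$, $$V_t^u(\pi)=\inf_{\gamma^1\in\mathcal B_t^1}\ \sup_{\gamma^2\in\mathcal B_t^2}\Big[\tilde c_t(\pi,\gamma^1,\gamma^2)+\sum_z\mathscr P_t^m(\pi,\gamma^1,\gamma^2;z)\,V_{t+1}^u\big(\Phi_t(\pi,\gamma^1,\gamma^2,z)\big)\Big].$$ **Theorem.** Suppose that only virtual player 1 controls the belief: there is a fixed transformation $F_t(\pi,\gamma^1,z)$,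 not depending on the strategies, such that under every strategy profile of $\mathscr G_e$, almost surely $\Pi_{t+1}=F_t(\Pi_t,\Gamma_t^1,Z_{t+1})$ for $1\le t<T$. Then $$S^u(\mathscr G)=S^u(\mathscr G_e)=\mathbb E[V_1^u(\Pi_1)],$$ both when $\Phi_t$ is the Bayesian update (the conditional law of $(X_{t+1},P_{t+1}^{1:2})$ given $Z_{t+1}=z$, with arbitrary values where $\mathscr P^m_t(\pi,\gamma^1,\gamma^2;z)=0$) and when $\Phi_t(\pi,\gamma^1,\gamma^2,z)=F_t(\pi,\gamma^1,z)$. Moreover, the maxima and the minimum in $S^u(\mathscr G)=\min_{g^1}\max_{g^2}J(g^1,g^2)$ are attained. -/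

import Mathlib

open Finset BigOperators

noncomputable section

/-- Probability distributions on a finite set. -/
abbrev Distr (A : Type) [Fintype A] : Type := stdSimplex ℝ A

/-- The distribution proportional to a nonnegative weight of positive total mass
(and the uniform distribution if there is no such normalization). -/
def Distr.normalize {A : Type} [Fintype A] [Nonempty A] (w : A → ℝ) : Distr A :=
  open Classical in
  if h : (∀ a, 0 ≤ w a) ∧ 0 < ∑ a, w a then
    ⟨fun a => w a / ∑ b, w b,
      fun a => div_nonneg (h.1 a) h.2.le, by
        rw [← Finset.sum_div]; exact div_self h.2.ne'⟩
  else
    ⟨fun _ => (Fintype.card A : ℝ)⁻¹, fun _ => by positivity, by simp⟩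

/-- The data of a stochastic zero-sum game between two teams over a finite horizon.

Teams `1` and `2` are indexed by `0, 1 : Fin 2`, and the times `1, …, T` by `0, …, T - 1`.  The data
are given at all times `t : ℕ`; what happens from time `T` on does not influence the cost.

The common information at time `t` is the tuple `C t = (Z 0, …, Z t)` of the successive increments,
and `P t i j` is the private information of player `j` of team `i`; at time `0` they are obtained
from the first observations, and they evolve through the fixed maps `ζ` and `ξ`. -/
structure TeamGame where
  /-- horizon -/
  T : ℕ
  /-- number of players in each team -/
  N : Fin 2 → ℕ
  /-- states -/
  X : ℕ → Type
  /-- actions of each player -/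
  U : ℕ → (i : Fin 2) → Fin (N i) → Type
  /-- observations of each player -/
  Y : ℕ → (i : Fin 2) → Fin (N i) → Type
  /-- private information of each player -/
  P : ℕ → (i : Fin 2) → Fin (N i) → Type
  /-- increments of the common information -/
  Z : ℕ → Type
  /-- system noise -/
  Ws : ℕ → Type
  /-- observation noise of each player -/
  Wo : ℕ → (i : Fin 2) → Fin (N i) → Type
  [fintypeX : ∀ t, Fintype (X t)]
  [fintypeU : ∀ t i j, Fintype (U t i j)]
  [fintypeY : ∀ t i j, Fintype (Y t i j)]
  [fintypeP : ∀ t i j, Fintype (P t i j)]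
  [fintypeZ : ∀ t, Fintype (Z t)]
  [fintypeWs : ∀ t, Fintype (Ws t)]
  [fintypeWo : ∀ t i j, Fintype (Wo t i j)]
  [nonemptyX : ∀ t, Nonempty (X t)]
  [nonemptyU : ∀ t i j, Nonempty (U t i j)]
  [nonemptyP : ∀ t i j, Nonempty (P t i j)]
  /-- distribution of the initial state -/
  distX : Distr (X 0)
  /-- distribution of the system noise -/
  distWs : ∀ t, Distr (Ws t)
  /-- distribution of the observation noise -/
  distWo : ∀ t i j, Distr (Wo t i j)
  /-- state evolution `X (t+1) = f (X t, U t, Ws t)` -/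
  f : ∀ t, X t → (∀ i j, U t i j) → Ws t → X (t + 1)
  /-- first observations -/
  h₀ : ∀ i j, X 0 → Wo 0 i j → Y 0 i j
  /-- later observations `Y (t+1) i j = h (X (t+1), U t, Wo (t+1) i j)` -/
  h : ∀ t i j, X (t + 1) → (∀ i j, U t i j) → Wo (t + 1) i j → Y (t + 1) i j
  /-- first common information -/
  ζ₀ : (∀ i j, Y 0 i j) → Z 0
  /-- increment of the common information -/
  ζ : ∀ t, (∀ i j, P t i j) → (∀ i j, U t i j) → (∀ i j, Y (t + 1) i j) → Z (t + 1)
  /-- first private information -/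
  ξ₀ : ∀ i, (∀ i j, Y 0 i j) → ∀ j, P 0 i j
  /-- evolution of the private information -/
  ξ : ∀ t i, (∀ i j, P t i j) → (∀ i j, U t i j) → (∀ i j, Y (t + 1) i j) → ∀ j, P (t + 1) i j
  /-- cost, as a function of the state and of the actions of the two teams -/
  cost : ∀ t, X t → (∀ j, U t 0 j) → (∀ j, U t 1 j) → ℝ

attribute [instance] TeamGame.fintypeX TeamGame.fintypeU TeamGame.fintypeY TeamGame.fintypeP
  TeamGame.fintypeZ TeamGame.fintypeWs TeamGame.fintypeWo TeamGame.nonemptyX TeamGame.nonemptyU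
  TeamGame.nonemptyP

namespace TeamGame

variable (G : TeamGame)

/-- Joint actions of all the players at time `t`. -/
abbrev Act (t : ℕ) : Type := ∀ i j, G.U t i j

/-- The state together with the private information of all the players. -/
abbrev State (t : ℕ) : Type := G.X t × (∀ i j, G.P t i j)

/-- Realizations of the common information at time `t`. -/
def C : ℕ → Type
  | 0 => G.Z 0
  | t + 1 => C t × G.Z (t + 1)

instance fintypeC : ∀ t, Fintype (G.C t)
  | 0 => G.fintypeZ 0
  | t + 1 => @instFintypeProd (G.C t) (G.Z (t + 1)) (fintypeC t) (G.fintypeZ (t + 1))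

/-- Prescriptions of (virtual player) `i` at time `t`: a map from private information to
distributions over actions, for each player of team `i`. -/
abbrev Presc (t : ℕ) (i : Fin 2) : Type := ∀ j, G.P t i j → Distr (G.U t i j)

/-- Probability that a prescription of a team assigns to a team action. -/
def teamProb {t : ℕ} {i : Fin 2} (γ : G.Presc t i) (p : ∀ j, G.P t i j) (u : ∀ j, G.U t i j) : ℝ :=
  ∏ j, (γ j (p j)).1 (u j)

/-- Probability of a joint action: all the players randomize independently. -/
def actProb {t : ℕ} (γ₁ : G.Presc t 0) (γ₂ : G.Presc t 1) (p : ∀ i j, G.P t i j) (u : G.Act t) : ℝ :=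
  G.teamProb γ₁ (p 0) (u 0) * G.teamProb γ₂ (p 1) (u 1)

/-- Probability of a realization of the (independent) observation noises at time `t`. -/
def noiseProb (t : ℕ) (w : ∀ i j, G.Wo t i j) : ℝ := ∏ i, ∏ j, (G.distWo t i j).1 (w i j)

/-- Joint probability of the first common information, state and private information. -/
def initProb (c : G.Z 0) (s : G.State 0) : ℝ :=
  open Classical in
  ∑ w : ∀ i j, G.Wo 0 i j, G.distX.1 s.1 * G.noiseProb 0 w *
    (let y : ∀ i j, G.Y 0 i j := fun i j => G.h₀ i j s.1 (w i j)
     if G.ζ₀ y = c ∧ (fun i => G.ξ₀ i y) = s.2 then 1 else 0)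

/-- Conditional probability of the next common increment `z`, state and private information
(`s'`) given the current state and private information (`s`) and the joint action `u`. -/
def transProb (t : ℕ) (s : G.State t) (u : G.Act t) (z : G.Z (t + 1)) (s' : G.State (t + 1)) : ℝ :=
  open Classical in
  ∑ ws : G.Ws t, ∑ w : ∀ i j, G.Wo (t + 1) i j,
    (G.distWs t).1 ws * G.noiseProb (t + 1) w *
    (let x' := G.f t s.1 u ws
     let y : ∀ i j, G.Y (t + 1) i j := fun i j => G.h t i j x' u (w i j)
     if x' = s'.1 ∧ G.ζ t s.2 u y = z ∧ (fun i => G.ξ t i s.2 u y) = s'.2 then 1 else 0)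

/-- Joint weight of `(z, s')` at time `t + 1` if the weight of the states at time `t` is `m` and the
prescriptions `γ₁, γ₂` are used at time `t`. -/
def nextJoint (t : ℕ) (m : G.State t → ℝ) (γ₁ : G.Presc t 0) (γ₂ : G.Presc t 1)
    (z : G.Z (t + 1)) (s' : G.State (t + 1)) : ℝ :=
  ∑ s, ∑ u, m s * G.actProb γ₁ γ₂ s.2 u * G.transProb t s u z s'

/-- The marginal weight of the common increment `z` in `nextJoint`. -/
def nextMarginal (t : ℕ) (m : G.State t → ℝ) (γ₁ : G.Presc t 0) (γ₂ : G.Presc t 1)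
    (z : G.Z (t + 1)) : ℝ :=
  ∑ s', G.nextJoint t m γ₁ γ₂ z s'

/-- Expected cost at time `t` if the weight of the states is `m` and the prescriptions `γ₁, γ₂` are
used. -/
def stageCost (t : ℕ) (m : G.State t → ℝ) (γ₁ : G.Presc t 0) (γ₂ : G.Presc t 1) : ℝ :=
  ∑ s, ∑ u : G.Act t, G.cost t s.1 (u 0) (u 1) * m s * G.actProb γ₁ γ₂ s.2 u

/-- A rule giving, at each time and for each realization of the common information, the way in
which both teams then randomize their actions as a function of the private information. -/
abbrev Rule : Type := ∀ t, G.C t → G.Presc t 0 × G.Presc t 1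

/-- The joint law of common information, state and private information at time `t` when actions
are generated by the rule `ρ`. -/
def law (ρ : G.Rule) : ∀ t, G.C t → G.State t → ℝ
  | 0 => G.initProb
  | t + 1 => fun cz => G.nextJoint t (law ρ t cz.1) (ρ t cz.1).1 (ρ t cz.1).2 cz.2

/-- Probability of a realization of the common information. -/
def commonProb (ρ : G.Rule) (t : ℕ) (c : G.C t) : ℝ := ∑ s, G.law ρ t c s

/-- Total expected cost when actions are generated by the rule `ρ`. -/
def totalCost (ρ : G.Rule) : ℝ :=
  ∑ t ∈ range G.T, ∑ c, G.stageCost t (G.law ρ t c) (ρ t c).1 (ρ t c).2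

/-! ### The original game -/

/-- Behavioral strategies of team `i`: a control law for each player and each time, mapping the
common information and the private information of the player to a distribution over its actions. -/
abbrev Strategy (i : Fin 2) : Type := ∀ t, ∀ j, G.C t → G.P t i j → Distr (G.U t i j)

/-- Total expected cost of a strategy profile in the original game. -/
def J (g₁ : G.Strategy 0) (g₂ : G.Strategy 1) : ℝ :=
  G.totalCost fun t c => (fun j => g₁ t j c, fun j => g₂ t j c)

/-- Upper value of the original game. -/
def upperValue : ℝ := ⨅ g₁, ⨆ g₂, G.J g₁ g₂

/-! ### The expanded game -/

/-- Prescription histories of both virtual players before time `t`. -/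
def PrescHist : ℕ → Type
  | 0 => Unit
  | t + 1 => PrescHist t × (G.Presc t 0 × G.Presc t 1)

/-- Strategies of virtual player `i` in the expanded game. -/
abbrev VStrategy (i : Fin 2) : Type := ∀ t, G.C t → G.PrescHist t → G.Presc t i

/-- The prescription history that has been generated under a strategy profile of the expanded game
when the common information is `c`. -/
def prescHist (χ₁ : G.VStrategy 0) (χ₂ : G.VStrategy 1) : ∀ t, G.C t → G.PrescHist t
  | 0 => fun _ => ()
  | t + 1 => fun cz => (prescHist χ₁ χ₂ t cz.1,
      (χ₁ t cz.1 (prescHist χ₁ χ₂ t cz.1), χ₂ t cz.1 (prescHist χ₁ χ₂ t cz.1)))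

/-- The prescriptions that are used at time `t` under a strategy profile of the expanded game when
the common information is `c`. -/
def play (χ₁ : G.VStrategy 0) (χ₂ : G.VStrategy 1) : G.Rule := fun t c =>
  (χ₁ t c (G.prescHist χ₁ χ₂ t c), χ₂ t c (G.prescHist χ₁ χ₂ t c))

/-- Total expected cost of a strategy profile in the expanded game. -/
def vJ (χ₁ : G.VStrategy 0) (χ₂ : G.VStrategy 1) : ℝ := G.totalCost (G.play χ₁ χ₂)

/-- Upper value of the expanded game. -/
def expandedUpperValue : ℝ := ⨅ χ₁, ⨆ χ₂, G.vJ χ₁ χ₂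

/-! ### Common information belief -/

/-- Beliefs on the state and the private information. -/
abbrev Belief (t : ℕ) : Type := Distr (G.State t)

/-- The common information belief at time `t` under a strategy profile of the expanded game: the
conditional distribution of state and private information given the common information and the
past prescriptions.  As the past prescriptions are a function of the common information (under
the given profile), it suffices to condition on the latter.  Only realizations `c` of positive
probability are relevant. -/
def cib (χ₁ : G.VStrategy 0) (χ₂ : G.VStrategy 1) (t : ℕ) (c : G.C t) : G.Belief t :=
  Distr.normalize (G.law (G.play χ₁ χ₂) t c)

/-- The common information belief at the initial time; it does not depend on any strategy. -/
def initialBelief (c : G.Z 0) : G.Belief 0 := Distr.normalize (G.initProb c)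

/-- Belief transformations, using the prescriptions of both virtual players. -/
abbrev Update : Type :=
  ∀ t, G.Belief t → G.Presc t 0 → G.Presc t 1 → G.Z (t + 1) → G.Belief (t + 1)

/-- Belief transformations that use the prescriptions of virtual player 1 only. -/
abbrev OneSidedUpdate : Type :=
  ∀ t, G.Belief t → G.Presc t 0 → G.Z (t + 1) → G.Belief (t + 1)

/-- The Bayesian update of the belief, with an arbitrary value `D` where the increment `z` has
probability zero. -/
def bayesUpdate (D : G.Update) : G.Update := fun t π γ₁ γ₂ z =>
  open Classical in
  if 0 < G.nextMarginal t π.1 γ₁ γ₂ z then Distr.normalize (G.nextJoint t π.1 γ₁ γ₂ z)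
  else D t π γ₁ γ₂ z

/-- Only virtual player 1 controls the common information belief: under every strategy profile of
the expanded game, `Π (t+1) = F (Π t, Γ₁ t, Z (t+1))` almost surely, at all times up to the
horizon, for the fixed transformation `F`. -/
def OnlyFirstControls (F : G.OneSidedUpdate) : Prop :=
  ∀ (χ₁ : G.VStrategy 0) (χ₂ : G.VStrategy 1) (t : ℕ), t + 1 < G.T →
    ∀ (c : G.C t) (z : G.Z (t + 1)), 0 < G.commonProb (G.play χ₁ χ₂) (t + 1) (c, z) →
      G.cib χ₁ χ₂ (t + 1) (c, z) = F t (G.cib χ₁ χ₂ t c) (G.play χ₁ χ₂ t c).1 z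

/-! ### The min-max dynamic program -/

/-- Value functions of the min-max dynamic program with belief update `Φ`, at time `t` and with `n`
remaining stages. -/
def upperV (Φ : G.Update) : ℕ → ∀ t, G.Belief t → ℝ
  | 0 => fun _ _ => 0
  | n + 1 => fun t π => ⨅ γ₁ : G.Presc t 0, ⨆ γ₂ : G.Presc t 1,
      (G.stageCost t π.1 γ₁ γ₂ +
        ∑ z, G.nextMarginal t π.1 γ₁ γ₂ z * upperV Φ n (t + 1) (Φ t π γ₁ γ₂ z))

/-- The expectation of the first value function at the initial common information belief. -/
def expectedUpperV (Φ : G.Update) : ℝ :=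
  ∑ c : G.Z 0, (∑ s, G.initProb c s) * G.upperV Φ G.T 0 (G.initialBelief c)

end TeamGame

end

/-! The theorem is the chain `expandedUpperValue` ≤ `upperValue` ≤ `expectedUpperV` ≤
`expandedUpperValue`, run once for each of the two belief updates. First link: once Team 1 follows a
fixed strategy of the original game, the prescription history is a function of the common
information, so a virtual player 2 has no more responses than Team 2. The other two links rest on
the gap identity `totalCost_sub_expectedUpperV`: if the update gives the true conditional beliefs
along a rule, expected values telescope and only the stagewise suboptimality remains. Middle link:
the one-sided update lets Team 1 compute the belief from the common information and its own past
choices, so nearly optimal prescriptions form a strategy of the original game. Last link: against a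
known strategy of virtual player 1, virtual player 2 recovers belief and current prescription from
the history and nearly maximizes at each stage. Attainment is separate: strategy spaces are compact
and `J` is continuous. -/

open Finset

/-! ### Normalization of weights and finite sums -/

namespace Distr

variable {A : Type} [Fintype A]

theorem normalize_smul [Nonempty A] {a : ℝ} (ha : 0 < a) (w : A → ℝ) :
    normalize (fun x => a * w x) = normalize w := by
  have hiff : ((∀ x, 0 ≤ a * w x) ∧ 0 < ∑ x, a * w x) ↔ ((∀ x, 0 ≤ w x) ∧ 0 < ∑ x, w x) := by
    rw [← mul_sum]
    simp only [mul_nonneg_iff_of_pos_left ha, mul_pos_iff_of_pos_left ha]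
  unfold normalize
  by_cases h : (∀ x, 0 ≤ w x) ∧ 0 < ∑ x, w x
  · rw [dif_pos h, dif_pos (hiff.2 h)]
    ext x
    simp only [← mul_sum]
    exact mul_div_mul_left _ _ ha.ne'
  · rw [dif_neg h, dif_neg (fun h' => h (hiff.1 h'))]

/-- No positive mass is needed: at total mass zero the weight vanishes identically, and the uniform
default is multiplied by 0. -/
theorem sum_mul_normalize [Nonempty A] {w : A → ℝ} (hw : ∀ a, 0 ≤ w a) (a : A) :
    (∑ b, w b) * (normalize w).1 a = w a := by
  rcases (sum_nonneg fun b _ => hw b : 0 ≤ ∑ b, w b).eq_or_lt with h | h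
  · have h0 := (sum_eq_zero_iff_of_nonneg fun b _ => hw b).1 h.symm a (mem_univ a)
    rw [← h, h0, zero_mul]
  · unfold normalize
    rw [dif_pos ⟨hw, h⟩]
    exact mul_div_cancel₀ _ h.ne'

theorem nonneg (π : Distr A) (a : A) : 0 ≤ π.1 a := π.2.1 a

theorem sum_eq_one (π : Distr A) : ∑ a, π.1 a = 1 := π.2.2

theorem le_one (π : Distr A) (a : A) : π.1 a ≤ 1 := by
  rw [← π.sum_eq_one]
  exact single_le_sum (fun b _ => π.nonneg b) (mem_univ a)

end Distr

theorem sum_pi_prod_eq_one {ι : Type} [Fintype ι] [DecidableEq ι] {A : ι → Type}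
    [∀ i, Fintype (A i)] (p : ∀ i, A i → ℝ) (hp : ∀ i, ∑ a, p i a = 1) :
    ∑ w : ∀ i, A i, ∏ i, p i (w i) = 1 := by
  rw [← Fintype.piFinset_univ, ← prod_univ_sum]
  simp [hp]

theorem sum_sum_comm {A B C D : Type} [Fintype A] [Fintype B] [Fintype C] [Fintype D]
    (φ : A → B → C → D → ℝ) :
    ∑ a, ∑ b, ∑ c, ∑ d, φ a b c d = ∑ c, ∑ d, ∑ a, ∑ b, φ a b c d := by
  simpa only [Fintype.sum_prod_type] using sum_comm (s := (univ : Finset (A × B)))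
    (t := (univ : Finset (C × D))) (f := fun x y => φ x.1 x.2 y.1 y.2)

namespace TeamGame

variable (G : TeamGame)

/-! ### The one-step kernels are stochastic -/

theorem noiseProb_nonneg (t : ℕ) (w : ∀ i j, G.Wo t i j) : 0 ≤ G.noiseProb t w :=
  prod_nonneg fun i _ => prod_nonneg fun j _ => (G.distWo t i j).nonneg _

theorem sum_noiseProb (t : ℕ) : ∑ w, G.noiseProb t w = 1 := by
  unfold noiseProb
  refine sum_pi_prod_eq_one (fun i (w : ∀ j, G.Wo t i j) => ∏ j, (G.distWo t i j).1 (w j)) ?_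
  intro i
  exact sum_pi_prod_eq_one _ fun j => (G.distWo t i j).sum_eq_one

theorem teamProb_nonneg {t : ℕ} {i : Fin 2} (γ : G.Presc t i) (p : ∀ j, G.P t i j)
    (u : ∀ j, G.U t i j) : 0 ≤ G.teamProb γ p u :=
  prod_nonneg fun j _ => (γ j (p j)).nonneg _

theorem sum_teamProb {t : ℕ} {i : Fin 2} (γ : G.Presc t i) (p : ∀ j, G.P t i j) :
    ∑ u, G.teamProb γ p u = 1 :=
  sum_pi_prod_eq_one _ fun j => (γ j (p j)).sum_eq_one

theorem actProb_nonneg {t : ℕ} (γ₁ : G.Presc t 0) (γ₂ : G.Presc t 1) (p : ∀ i j, G.P t i j)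
    (u : G.Act t) : 0 ≤ G.actProb γ₁ γ₂ p u :=
  mul_nonneg (G.teamProb_nonneg _ _ _) (G.teamProb_nonneg _ _ _)

theorem sum_actProb {t : ℕ} (γ₁ : G.Presc t 0) (γ₂ : G.Presc t 1) (p : ∀ i j, G.P t i j) :
    ∑ u, G.actProb γ₁ γ₂ p u = 1 := by
  have h : ∑ u, G.actProb γ₁ γ₂ p u = ∑ v : (∀ j, G.U t 0 j) × (∀ j, G.U t 1 j),
      G.teamProb γ₁ (p 0) v.1 * G.teamProb γ₂ (p 1) v.2 :=
    Fintype.sum_equiv (piFinTwoEquiv fun i => ∀ j, G.U t i j) _ _ fun u => rfl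
  rw [h, Fintype.sum_prod_type, ← Fintype.sum_mul_sum, G.sum_teamProb, G.sum_teamProb, one_mul]

theorem actProb_le_one {t : ℕ} (γ₁ : G.Presc t 0) (γ₂ : G.Presc t 1) (p : ∀ i j, G.P t i j)
    (u : G.Act t) : G.actProb γ₁ γ₂ p u ≤ 1 := by
  rw [← G.sum_actProb γ₁ γ₂ p]
  exact single_le_sum (fun v _ => G.actProb_nonneg _ _ _ v) (mem_univ u)

theorem initProb_nonneg (c : G.Z 0) (s : G.State 0) : 0 ≤ G.initProb c s := by
  classical
  refine sum_nonneg fun w _ => mul_nonneg (mul_nonneg (G.distX.nonneg _) (G.noiseProb_nonneg _ _)) ?_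
  dsimp only
  split_ifs <;> norm_num

theorem sum_initProb : ∑ c, ∑ s, G.initProb c s = 1 := by
  classical
  unfold initProb
  simp only [Fintype.sum_prod_type]
  rw [sum_comm]
  have hx (x : G.X 0) : ∑ c, ∑ p : (∀ i j, G.P 0 i j), ∑ w : ∀ i j, G.Wo 0 i j,
      G.distX.1 x * G.noiseProb 0 w *
        (if G.ζ₀ (fun i j => G.h₀ i j x (w i j)) = c ∧
          (fun i => G.ξ₀ i fun i j => G.h₀ i j x (w i j)) = p then 1 else 0) = G.distX.1 x := by
    simp_rw [sum_comm (t := (univ : Finset (∀ i j, G.Wo 0 i j))), ← mul_sum, ite_and]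
    simp [← mul_sum, G.sum_noiseProb]
  simp only [hx, G.distX.sum_eq_one]

theorem transProb_nonneg (t : ℕ) (s : G.State t) (u : G.Act t) (z : G.Z (t + 1))
    (s' : G.State (t + 1)) : 0 ≤ G.transProb t s u z s' := by
  classical
  refine sum_nonneg fun ws _ => sum_nonneg fun w _ =>
    mul_nonneg (mul_nonneg ((G.distWs t).nonneg _) (G.noiseProb_nonneg _ _)) ?_
  dsimp only
  split_ifs <;> norm_num

theorem sum_transProb (t : ℕ) (s : G.State t) (u : G.Act t) :
    ∑ z, ∑ s', G.transProb t s u z s' = 1 := by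
  classical
  unfold transProb
  rw [sum_sum_comm]
  simp only [← mul_sum, Fintype.sum_prod_type, ite_and]
  simp [← mul_sum, G.sum_noiseProb, (G.distWs t).sum_eq_one]

theorem nextJoint_nonneg (t : ℕ) {m : G.State t → ℝ} (hm : ∀ s, 0 ≤ m s) (γ₁ : G.Presc t 0)
    (γ₂ : G.Presc t 1) (z : G.Z (t + 1)) (s' : G.State (t + 1)) :
    0 ≤ G.nextJoint t m γ₁ γ₂ z s' :=
  sum_nonneg fun s _ => sum_nonneg fun _ _ =>
    mul_nonneg (mul_nonneg (hm s) (G.actProb_nonneg _ _ _ _)) (G.transProb_nonneg _ _ _ _ _)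

theorem nextMarginal_nonneg (t : ℕ) {m : G.State t → ℝ} (hm : ∀ s, 0 ≤ m s) (γ₁ : G.Presc t 0)
    (γ₂ : G.Presc t 1) (z : G.Z (t + 1)) : 0 ≤ G.nextMarginal t m γ₁ γ₂ z :=
  sum_nonneg fun s' _ => G.nextJoint_nonneg t hm γ₁ γ₂ z s'

theorem sum_nextMarginal (t : ℕ) (m : G.State t → ℝ) (γ₁ : G.Presc t 0) (γ₂ : G.Presc t 1) :
    ∑ z, G.nextMarginal t m γ₁ γ₂ z = ∑ s, m s := by
  unfold nextMarginal nextJoint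
  rw [sum_sum_comm]
  simp_rw [← mul_sum, G.sum_transProb, mul_one, ← mul_sum, G.sum_actProb, mul_one]

theorem nextJoint_smul (t : ℕ) (a : ℝ) (m : G.State t → ℝ) (γ₁ : G.Presc t 0) (γ₂ : G.Presc t 1)
    (z : G.Z (t + 1)) (s' : G.State (t + 1)) :
    G.nextJoint t (fun s => a * m s) γ₁ γ₂ z s' = a * G.nextJoint t m γ₁ γ₂ z s' := by
  simp only [nextJoint, mul_sum, mul_assoc]

theorem nextMarginal_smul (t : ℕ) (a : ℝ) (m : G.State t → ℝ) (γ₁ : G.Presc t 0)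
    (γ₂ : G.Presc t 1) (z : G.Z (t + 1)) :
    G.nextMarginal t (fun s => a * m s) γ₁ γ₂ z = a * G.nextMarginal t m γ₁ γ₂ z := by
  simp only [nextMarginal, nextJoint_smul, mul_sum]

theorem stageCost_smul (t : ℕ) (a : ℝ) (m : G.State t → ℝ) (γ₁ : G.Presc t 0)
    (γ₂ : G.Presc t 1) :
    G.stageCost t (fun s => a * m s) γ₁ γ₂ = a * G.stageCost t m γ₁ γ₂ := by
  simp only [stageCost, mul_sum]
  exact sum_congr rfl fun s _ => sum_congr rfl fun u _ => by ring

/-- A bound for the expected cost at time `t`. -/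
noncomputable def costBound (t : ℕ) : ℝ := ∑ s : G.State t, ∑ u : G.Act t, |G.cost t s.1 (u 0) (u 1)|

theorem abs_stageCost_le (t : ℕ) (π : G.Belief t) (γ₁ : G.Presc t 0) (γ₂ : G.Presc t 1) :
    |G.stageCost t π.1 γ₁ γ₂| ≤ G.costBound t := by
  refine (abs_sum_le_sum_abs _ _).trans (sum_le_sum fun s _ =>
    (abs_sum_le_sum_abs _ _).trans (sum_le_sum fun u _ => ?_))
  rw [abs_mul, abs_mul, abs_of_nonneg (π.nonneg s), abs_of_nonneg (G.actProb_nonneg _ _ _ _),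
    mul_assoc]
  exact mul_le_of_le_one_right (abs_nonneg _)
    (mul_le_one₀ (π.le_one s) (G.actProb_nonneg _ _ _ _) (G.actProb_le_one _ _ _ _))

/-! ### Laws and conditional beliefs along a rule -/

theorem law_nonneg (ρ : G.Rule) : ∀ t c s, 0 ≤ G.law ρ t c s
  | 0, c, s => G.initProb_nonneg c s
  | t + 1, (c, z), s' => G.nextJoint_nonneg t (law_nonneg ρ t c) _ _ z s'

theorem commonProb_nonneg (ρ : G.Rule) (t : ℕ) (c : G.C t) : 0 ≤ G.commonProb ρ t c :=
  sum_nonneg fun s _ => G.law_nonneg ρ t c s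

/-- The conditional distribution of state and private information given the common information
when actions are generated by the rule `ρ`. -/
noncomputable def condBelief (ρ : G.Rule) (t : ℕ) (c : G.C t) : G.Belief t := Distr.normalize (G.law ρ t c)

theorem law_eq (ρ : G.Rule) (t : ℕ) (c : G.C t) :
    G.law ρ t c = fun s => G.commonProb ρ t c * (G.condBelief ρ t c).1 s :=
  funext fun s => (Distr.sum_mul_normalize (G.law_nonneg ρ t c) s).symm

theorem stageCost_law (ρ : G.Rule) (t : ℕ) (c : G.C t) (γ₁ : G.Presc t 0) (γ₂ : G.Presc t 1) :
    G.stageCost t (G.law ρ t c) γ₁ γ₂ =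
      G.commonProb ρ t c * G.stageCost t (G.condBelief ρ t c).1 γ₁ γ₂ := by
  rw [law_eq, stageCost_smul]

theorem commonProb_succ (ρ : G.Rule) (t : ℕ) (c : G.C t) (z : G.Z (t + 1)) :
    G.commonProb ρ (t + 1) (c, z) =
      G.commonProb ρ t c * G.nextMarginal t (G.condBelief ρ t c).1 (ρ t c).1 (ρ t c).2 z := by
  rw [← nextMarginal_smul, ← law_eq]
  rfl

theorem sum_C_succ (t : ℕ) (φ : G.C (t + 1) → ℝ) : ∑ cz, φ cz = ∑ c, ∑ z, φ (c, z) :=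
  Fintype.sum_prod_type (α₁ := G.C t) (α₂ := G.Z (t + 1)) φ

theorem sum_commonProb (ρ : G.Rule) : ∀ t, ∑ c, G.commonProb ρ t c = 1
  | 0 => G.sum_initProb
  | t + 1 => by
    rw [sum_C_succ]
    simp_rw [commonProb_succ, ← mul_sum, sum_nextMarginal, Distr.sum_eq_one, mul_one]
    exact sum_commonProb ρ t

theorem commonProb_pos_of_succ {ρ : G.Rule} {t : ℕ} {c : G.C t} {z : G.Z (t + 1)}
    (h : 0 < G.commonProb ρ (t + 1) (c, z)) :
    0 < G.commonProb ρ t c ∧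
      0 < G.nextMarginal t (G.condBelief ρ t c).1 (ρ t c).1 (ρ t c).2 z := by
  rw [commonProb_succ] at h
  exact ⟨pos_of_mul_pos_left h (G.nextMarginal_nonneg t (Distr.nonneg _) _ _ z),
    pos_of_mul_pos_right h (G.commonProb_nonneg ρ t c)⟩

/-- Bayes' rule in one step: `nextJoint` is homogeneous in the current weight and `normalize`
ignores positive factors, so the unnormalized law may be replaced by the belief. -/
theorem condBelief_succ {ρ : G.Rule} {t : ℕ} {c : G.C t} {z : G.Z (t + 1)}
    (h : 0 < G.commonProb ρ t c) :
    G.condBelief ρ (t + 1) (c, z) =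
      Distr.normalize (G.nextJoint t (G.condBelief ρ t c).1 (ρ t c).1 (ρ t c).2 z) := by
  have h1 : G.law ρ (t + 1) (c, z) = fun s' => G.commonProb ρ t c *
      G.nextJoint t (G.condBelief ρ t c).1 (ρ t c).1 (ρ t c).2 z s' := by
    funext s'
    rw [← nextJoint_smul, ← law_eq]
    rfl
  exact (congrArg Distr.normalize h1).trans (Distr.normalize_smul h _)

/-- Real `⨆` and `⨅` are meaningful only for bounded families; this uniform bound supplies that for
both games. -/
theorem abs_totalCost_le (ρ : G.Rule) : |G.totalCost ρ| ≤ ∑ t ∈ range G.T, G.costBound t := by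
  refine (abs_sum_le_sum_abs _ _).trans (sum_le_sum fun t _ => (abs_sum_le_sum_abs _ _).trans ?_)
  rw [← one_mul (G.costBound t), ← G.sum_commonProb ρ t, sum_mul]
  refine sum_le_sum fun c _ => ?_
  rw [stageCost_law, abs_mul, abs_of_nonneg (G.commonProb_nonneg ρ t c)]
  exact mul_le_mul_of_nonneg_left (G.abs_stageCost_le t _ _ _) (G.commonProb_nonneg ρ t c)

theorem bddAbove_range_totalCost {ι : Type} (ρ : ι → G.Rule) :
    BddAbove (Set.range fun i => G.totalCost (ρ i)) :=
  ⟨_, Set.forall_mem_range.2 fun i => (abs_le.1 (G.abs_totalCost_le (ρ i))).2⟩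

theorem bddBelow_range_iSup_totalCost {ι κ : Type} [Nonempty κ] (ρ : ι → κ → G.Rule) :
    BddBelow (Set.range fun i => ⨆ k, G.totalCost (ρ i k)) := by
  refine ⟨-∑ t ∈ range G.T, G.costBound t, Set.forall_mem_range.2 fun i => ?_⟩
  exact (abs_le.1 (G.abs_totalCost_le (ρ i (Classical.arbitrary κ)))).1.trans
    (le_ciSup (G.bddAbove_range_totalCost (ρ i)) _)

/-! ### The dynamic program -/

/-- The quantity optimized in the dynamic program at time `t`, with `n` stages remaining after
time `t`. -/
noncomputable def qValue (Φ : G.Update) (n t : ℕ) (π : G.Belief t) (γ₁ : G.Presc t 0) (γ₂ : G.Presc t 1) : ℝ :=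
  G.stageCost t π.1 γ₁ γ₂ +
    ∑ z, G.nextMarginal t π.1 γ₁ γ₂ z * G.upperV Φ n (t + 1) (Φ t π γ₁ γ₂ z)

theorem upperV_succ (Φ : G.Update) (n t : ℕ) (π : G.Belief t) :
    G.upperV Φ (n + 1) t π = ⨅ γ₁, ⨆ γ₂, G.qValue Φ n t π γ₁ γ₂ := rfl

/-- The next increment has total probability one, so averaging preserves the bound `B`. It must be
uniform in the belief because `Φ` is arbitrary. -/
theorem abs_qValue_le {Φ : G.Update} {n t : ℕ} {B : ℝ}
    (hB : ∀ π, |G.upperV Φ n (t + 1) π| ≤ B) (π : G.Belief t) (γ₁ : G.Presc t 0)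
    (γ₂ : G.Presc t 1) : |G.qValue Φ n t π γ₁ γ₂| ≤ G.costBound t + B := by
  refine (abs_add_le _ _).trans (add_le_add (G.abs_stageCost_le t π γ₁ γ₂) ?_)
  calc _ ≤ ∑ z, G.nextMarginal t π.1 γ₁ γ₂ z * B := by
        refine (abs_sum_le_sum_abs _ _).trans (sum_le_sum fun z _ => ?_)
        rw [abs_mul, abs_of_nonneg (G.nextMarginal_nonneg t π.nonneg _ _ z)]
        exact mul_le_mul_of_nonneg_left (hB _) (G.nextMarginal_nonneg t π.nonneg _ _ z)
    _ = B := by rw [← sum_mul, sum_nextMarginal, π.sum_eq_one, one_mul]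

theorem exists_abs_upperV_le (Φ : G.Update) : ∀ n t, ∃ B : ℝ, ∀ π, |G.upperV Φ n t π| ≤ B
  | 0, _ => ⟨0, fun _ => abs_zero.le⟩
  | n + 1, t => by
    obtain ⟨B, hB⟩ := exists_abs_upperV_le Φ n (t + 1)
    refine ⟨G.costBound t + B, fun π => ?_⟩
    have hq γ₁ γ₂ := abs_le.1 (G.abs_qValue_le hB π γ₁ γ₂)
    have hs γ₁ : BddAbove (Set.range fun γ₂ => G.qValue Φ n t π γ₁ γ₂) :=
      ⟨_, Set.forall_mem_range.2 fun γ₂ => (hq γ₁ γ₂).2⟩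
    have hl γ₁ : -(G.costBound t + B) ≤ ⨆ γ₂, G.qValue Φ n t π γ₁ γ₂ :=
      (hq γ₁ (Classical.arbitrary _)).1.trans (le_ciSup (hs γ₁) _)
    rw [upperV_succ, abs_le]
    refine ⟨le_ciInf hl, ?_⟩
    exact (ciInf_le ⟨_, Set.forall_mem_range.2 hl⟩ (Classical.arbitrary _)).trans
      (ciSup_le fun γ₂ => (hq _ γ₂).2)

theorem bddAbove_range_qValue (Φ : G.Update) (n t : ℕ) (π : G.Belief t) (γ₁ : G.Presc t 0) :
    BddAbove (Set.range fun γ₂ => G.qValue Φ n t π γ₁ γ₂) := by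
  obtain ⟨B, hB⟩ := G.exists_abs_upperV_le Φ n (t + 1)
  exact ⟨_, Set.forall_mem_range.2 fun γ₂ => (abs_le.1 (G.abs_qValue_le hB π γ₁ γ₂)).2⟩

theorem bddBelow_range_iSup_qValue (Φ : G.Update) (n t : ℕ) (π : G.Belief t) :
    BddBelow (Set.range fun γ₁ => ⨆ γ₂, G.qValue Φ n t π γ₁ γ₂) := by
  obtain ⟨B, hB⟩ := G.exists_abs_upperV_le Φ n (t + 1)
  exact ⟨_, Set.forall_mem_range.2 fun γ₁ =>
    (abs_le.1 (G.abs_qValue_le hB π γ₁ (Classical.arbitrary _))).1.trans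
      (le_ciSup (G.bddAbove_range_qValue Φ n t π γ₁) _)⟩

/-- Only near-optimality is claimed: with an arbitrary `Φ` the value functions need not be
continuous, so the infimum may not be attained. -/
theorem exists_forall_qValue_le (Φ : G.Update) (n t : ℕ) (π : G.Belief t) {ε : ℝ} (hε : 0 < ε) :
    ∃ γ₁, ∀ γ₂, G.qValue Φ n t π γ₁ γ₂ ≤ G.upperV Φ (n + 1) t π + ε := by
  obtain ⟨γ₁, h⟩ := exists_lt_of_ciInf_lt (lt_add_of_pos_right (G.upperV Φ (n + 1) t π) hε)
  exact ⟨γ₁, fun γ₂ => (le_ciSup (G.bddAbove_range_qValue Φ n t π γ₁) γ₂).trans h.le⟩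

theorem exists_le_qValue (Φ : G.Update) (n t : ℕ) (π : G.Belief t) (γ₁ : G.Presc t 0) {ε : ℝ}
    (hε : 0 < ε) : ∃ γ₂, G.upperV Φ (n + 1) t π - ε ≤ G.qValue Φ n t π γ₁ γ₂ := by
  have h : G.upperV Φ (n + 1) t π - ε < ⨆ γ₂, G.qValue Φ n t π γ₁ γ₂ :=
    (sub_lt_self _ hε).trans_le (ciInf_le (G.bddBelow_range_iSup_qValue Φ n t π) γ₁)
  obtain ⟨γ₂, h⟩ := exists_lt_of_lt_ciSup h
  exact ⟨γ₂, h.le⟩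

/-- The belief update `Φ` yields the conditional beliefs along the rule `ρ`, almost surely and up to
the horizon. -/
def Tracks (Φ : G.Update) (ρ : G.Rule) : Prop :=
  ∀ t, t + 1 < G.T → ∀ (c : G.C t) (z : G.Z (t + 1)), 0 < G.commonProb ρ (t + 1) (c, z) →
    G.condBelief ρ (t + 1) (c, z) = Φ t (G.condBelief ρ t c) (ρ t c).1 (ρ t c).2 z

/-- This holds for every rule: at histories of positive probability the increment has positive
conditional probability, so the default `D` is never consulted. -/
theorem tracks_bayesUpdate (D : G.Update) (ρ : G.Rule) : G.Tracks (G.bayesUpdate D) ρ := by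
  intro t _ c z h
  obtain ⟨h1, h2⟩ := G.commonProb_pos_of_succ h
  rw [bayesUpdate, if_pos h2, condBelief_succ G h1]

/-- The cost of a rule exceeds the value of the dynamic program by the expected sum of the amounts
by which the prescriptions fail to be optimal. -/
theorem totalCost_sub_expectedUpperV {Φ : G.Update} {ρ : G.Rule} (h : G.Tracks Φ ρ) :
    G.totalCost ρ - G.expectedUpperV Φ = ∑ t ∈ range G.T, ∑ c, G.commonProb ρ t c *
      (G.qValue Φ (G.T - t - 1) t (G.condBelief ρ t c) (ρ t c).1 (ρ t c).2 -
        G.upperV Φ (G.T - t) t (G.condBelief ρ t c)) := by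
  -- `W t` is the expected value of the dynamic program from time `t` on; the stagewise gaps are the
  -- stage cost plus an increment of `W`.
  set W : ℕ → ℝ := fun t => ∑ c, G.commonProb ρ t c * G.upperV Φ (G.T - t) t (G.condBelief ρ t c)
    with hW
  have hstep (t) (ht : t ∈ range G.T) : ∑ c, G.commonProb ρ t c *
      (G.qValue Φ (G.T - t - 1) t (G.condBelief ρ t c) (ρ t c).1 (ρ t c).2 -
        G.upperV Φ (G.T - t) t (G.condBelief ρ t c)) =
      ∑ c, G.stageCost t (G.law ρ t c) (ρ t c).1 (ρ t c).2 + (W (t + 1) - W t) := by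
    have hnext : W (t + 1) = ∑ c, G.commonProb ρ t c *
        ∑ z, G.nextMarginal t (G.condBelief ρ t c).1 (ρ t c).1 (ρ t c).2 z *
          G.upperV Φ (G.T - t - 1) (t + 1) (Φ t (G.condBelief ρ t c) (ρ t c).1 (ρ t c).2 z) := by
      simp only [hW, sum_C_succ, mul_sum, ← mul_assoc, ← commonProb_succ, Nat.sub_sub]
      refine sum_congr rfl fun c _ => sum_congr rfl fun z _ => ?_
      rcases (G.commonProb_nonneg ρ (t + 1) (c, z)).eq_or_lt with h0 | hpos
      · rw [← h0, zero_mul, zero_mul]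
      · rcases (Nat.succ_le_of_lt (mem_range.1 ht)).eq_or_lt with hT | hT
        -- At the horizon the value is 0 at every belief, so `Tracks` is not needed for the last
        -- update.
        · rw [← hT, Nat.sub_self]
          rfl
        · rw [h t hT c z hpos]
    rw [hnext]
    simp only [hW, stageCost_law, qValue, ← sum_add_distrib, ← sum_sub_distrib]
    exact sum_congr rfl fun c _ => by ring
  rw [sum_congr rfl hstep, sum_add_distrib, sum_range_sub]
  have hT : W G.T = 0 := by
    simp only [hW, Nat.sub_self]
    exact sum_eq_zero fun c _ => mul_zero _
  have h0 : W 0 = G.expectedUpperV Φ := rfl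
  rw [hT, h0, totalCost]
  ring

/-- Null histories carry no weight in the gap identity. Restricting the hypothesis to positive
probability matters, since the belief that Team 1 computes is only guaranteed correct there. -/
theorem totalCost_le {Φ : G.Update} {ρ : G.Rule} (h : G.Tracks Φ ρ) {ε : ℝ}
    (hε : ∀ t < G.T, ∀ c, 0 < G.commonProb ρ t c →
      G.qValue Φ (G.T - t - 1) t (G.condBelief ρ t c) (ρ t c).1 (ρ t c).2 ≤
        G.upperV Φ (G.T - t) t (G.condBelief ρ t c) + ε) :
    G.totalCost ρ ≤ G.expectedUpperV Φ + G.T * ε := by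
  rw [← sub_le_iff_le_add', totalCost_sub_expectedUpperV G h]
  refine (sum_le_sum (g := fun _ => ε) fun t ht => ?_).trans
    (by rw [sum_const, card_range, nsmul_eq_mul])
  rw [← one_mul ε, ← G.sum_commonProb ρ t, sum_mul]
  refine sum_le_sum fun c _ => ?_
  rcases (G.commonProb_nonneg ρ t c).eq_or_lt with h0 | hpos
  · rw [← h0, zero_mul, zero_mul]
  · exact mul_le_mul_of_nonneg_left
      (sub_le_iff_le_add'.2 (hε t (mem_range.1 ht) c hpos)) hpos.le

theorem le_totalCost {Φ : G.Update} {ρ : G.Rule} (h : G.Tracks Φ ρ) {ε : ℝ}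
    (hε : ∀ t < G.T, ∀ c, G.upperV Φ (G.T - t) t (G.condBelief ρ t c) - ε ≤
      G.qValue Φ (G.T - t - 1) t (G.condBelief ρ t c) (ρ t c).1 (ρ t c).2) :
    G.expectedUpperV Φ - G.T * ε ≤ G.totalCost ρ := by
  have key : ∑ t ∈ range G.T, (-ε) ≤ G.totalCost ρ - G.expectedUpperV Φ := by
    rw [totalCost_sub_expectedUpperV G h]
    refine sum_le_sum fun t ht => ?_
    rw [← one_mul (-ε), ← G.sum_commonProb ρ t, sum_mul]
    exact sum_le_sum fun c _ => mul_le_mul_of_nonneg_left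
      (by linarith [hε t (mem_range.1 ht) c]) (G.commonProb_nonneg ρ t c)
  rw [sum_const, card_range, nsmul_eq_mul] at key
  linarith

/-! ### Comparison of the upper values -/

/-- The strategy of a virtual player that follows a strategy of the original game. -/
def Strategy.toVirtual {G : TeamGame} {i : Fin 2} (g : G.Strategy i) : G.VStrategy i :=
  fun t c _ j => g t j c

theorem expandedUpperValue_le_upperValue : G.expandedUpperValue ≤ G.upperValue := by
  refine le_ciInf fun g₁ => ?_
  refine (ciInf_le (G.bddBelow_range_iSup_totalCost fun χ₁ χ₂ => G.play χ₁ χ₂)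
    g₁.toVirtual).trans (ciSup_le fun χ₂ => ?_)
  -- The response replays `χ₂` along the history generated by the common information; both profiles
  -- then induce the same rule.
  exact le_ciSup (G.bddAbove_range_totalCost fun (g₂ : G.Strategy 1) t c =>
      (fun j => g₁ t j c, fun j => g₂ t j c))
    fun t j c => χ₂ t c (G.prescHist g₁.toVirtual χ₂ t c) j

/-- The joint law of common information, state and private information, computed from the past
prescriptions. -/
noncomputable def histLaw : ∀ t, G.C t → G.PrescHist t → G.State t → ℝ
  | 0 => fun c _ => G.initProb c
  | t + 1 => fun cz h => G.nextJoint t (histLaw t cz.1 h.1) h.2.1 h.2.2 cz.2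

/-- The strategies enter the law only through the realized prescriptions, so virtual player 2 can
compute the belief from what it observes. -/
theorem law_play (χ₁ : G.VStrategy 0) (χ₂ : G.VStrategy 1) :
    ∀ t c, G.law (G.play χ₁ χ₂) t c = G.histLaw t c (G.prescHist χ₁ χ₂ t c)
  | 0, _ => rfl
  | t + 1, (c, z) => by
    change G.nextJoint t (G.law (G.play χ₁ χ₂) t c) _ _ z = _
    rw [law_play χ₁ χ₂ t c]
    rfl

theorem expectedUpperV_le_expandedUpperValue {Φ : G.Update}
    (h : ∀ χ₁ χ₂, G.Tracks Φ (G.play χ₁ χ₂)) : G.expectedUpperV Φ ≤ G.expandedUpperValue := by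
  refine le_ciInf fun χ₁ => le_of_forall_pos_le_add fun δ hδ => ?_
  -- Each of the `T` stages may lose this much; the `+ 1` keeps the denominator positive when `T =
  -- 0`.
  have hε : 0 < δ / (G.T + 1) := by positivity
  choose b hb using fun n t π γ₁ => G.exists_le_qValue Φ n t π γ₁ hε
  -- As `χ₁` is fixed before the supremum, the response may depend on its current prescription `χ₁ t
  -- c hist`, matching the order inf-sup in the dynamic program.
  let χ₂ : G.VStrategy 1 := fun t c hist =>
    b (G.T - t - 1) t (Distr.normalize (G.histLaw t c hist)) (χ₁ t c hist)
  have hle := G.le_totalCost (h χ₁ χ₂) (ε := δ / (G.T + 1)) fun t ht c => by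
    have hn : G.T - t = G.T - t - 1 + 1 := by omega
    have hc : G.condBelief (G.play χ₁ χ₂) t c =
        Distr.normalize (G.histLaw t c (G.prescHist χ₁ χ₂ t c)) := by
      rw [condBelief, law_play]
    rw [hc]
    nth_rewrite 1 [hn]
    exact hb _ _ _ _
  have hT : G.T * (δ / (G.T + 1)) ≤ δ := by
    rw [← mul_div_assoc, div_le_iff₀ (by positivity)]
    nlinarith
  have hsup : G.vJ χ₁ χ₂ ≤ ⨆ χ₂, G.vJ χ₁ χ₂ :=
    le_ciSup (G.bddAbove_range_totalCost fun χ₂ => G.play χ₁ χ₂) χ₂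
  have hvJ : G.vJ χ₁ χ₂ = G.totalCost (G.play χ₁ χ₂) := rfl
  linarith

/-- The belief computed from the common information by a one-sided update when virtual player 1
selects its prescriptions according to the belief by `a`. -/
noncomputable def oneSidedBelief (F : G.OneSidedUpdate) (a : ∀ t, G.Belief t → G.Presc t 0) :
    ∀ t, G.C t → G.Belief t
  | 0 => G.initialBelief
  | t + 1 => fun cz => F t (oneSidedBelief F a t cz.1) (a t (oneSidedBelief F a t cz.1)) cz.2

/-- `F` computes the belief without Team 2's prescriptions, which Team 1 does not observe; `Φ` only
defines the values and may be a different update. -/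
theorem upperValue_le_expectedUpperV {F : G.OneSidedUpdate} (hF : G.OnlyFirstControls F)
    {Φ : G.Update} (h : ∀ χ₁ χ₂, G.Tracks Φ (G.play χ₁ χ₂)) :
    G.upperValue ≤ G.expectedUpperV Φ := by
  refine le_of_forall_pos_le_add fun δ hδ => ?_
  have hε : 0 < δ / (G.T + 1) := by positivity
  choose a ha using fun n t π => G.exists_forall_qValue_le Φ n t π hε
  let b := G.oneSidedBelief F fun t π => a (G.T - t - 1) t π
  -- Since `b t c` depends on `c` alone, this is a strategy of the original game.
  let g₁ : G.Strategy 0 := fun t j c => a (G.T - t - 1) t (b t c) j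
  refine (ciInf_le (G.bddBelow_range_iSup_totalCost fun (g₁ : G.Strategy 0) (g₂ : G.Strategy 1) t c =>
    (fun j => g₁ t j c, fun j => g₂ t j c)) g₁).trans (ciSup_le fun g₂ => ?_)
  -- Whatever Team 2 plays, the computed belief is the true one at every history of positive
  -- probability.
  have hbel : ∀ t < G.T, ∀ c, 0 < G.commonProb (G.play g₁.toVirtual g₂.toVirtual) t c →
      G.condBelief (G.play g₁.toVirtual g₂.toVirtual) t c = b t c := by
    intro t
    induction t with
    | zero => exact fun _ _ _ => rfl
    | succ t ih =>
      rintro ht ⟨c, z⟩ hc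
      have hb := ih (by omega) c (G.commonProb_pos_of_succ hc).1
      have hstep : G.condBelief (G.play g₁.toVirtual g₂.toVirtual) (t + 1) (c, z) =
        F t (G.condBelief (G.play g₁.toVirtual g₂.toVirtual) t c) _ z := hF _ _ t ht c z hc
      rw [hstep, hb]
      -- After rewriting with `hb`, Team 1's prescription is the one selected at `b t c`, which is
      -- the recursion of `oneSidedBelief`.
      rfl
  have hle := G.totalCost_le (h g₁.toVirtual g₂.toVirtual) (ε := δ / (G.T + 1)) fun t ht c hc => by
    have hn : G.T - t = G.T - t - 1 + 1 := by omega
    rw [hbel t ht c hc]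
    nth_rewrite 2 [hn]
    exact ha _ _ _ _
  have hT : G.T * (δ / (G.T + 1)) ≤ δ := by
    rw [← mul_div_assoc, div_le_iff₀ (by positivity)]
    nlinarith
  have hJ : G.J g₁ g₂ = G.totalCost (G.play g₁.toVirtual g₂.toVirtual) := rfl
  exact hJ.le.trans (hle.trans (by linarith))

/-! ### Continuity of the cost and attainment -/

theorem continuous_actProb {E : Type} [TopologicalSpace E] {t : ℕ} {γ₁ : E → G.Presc t 0}
    {γ₂ : E → G.Presc t 1} (h₁ : Continuous γ₁) (h₂ : Continuous γ₂) (p : ∀ i j, G.P t i j)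
    (u : G.Act t) : Continuous fun e => G.actProb (γ₁ e) (γ₂ e) p u := by
  have key {i : Fin 2} {γ : E → G.Presc t i} (h : Continuous γ) :
      Continuous fun e => G.teamProb (γ e) (p i) (u i) := by
    refine continuous_finsetProd _ fun j _ => ?_
    have hj : Continuous fun e => γ e j (p i j) :=
      (continuous_apply _).comp ((continuous_apply _).comp h)
    exact (continuous_apply _).comp (continuous_subtype_val.comp hj)
  exact (key h₁).mul (key h₂)

/-- Each entry is built from finitely many coordinates of the rule by sums and products, so the
product topology suffices even with infinitely many times. -/
theorem continuous_law {E : Type} [TopologicalSpace E] {ρ : E → G.Rule} (h : Continuous ρ) :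
    ∀ t c s, Continuous fun e => G.law (ρ e) t c s
  | 0, _, _ => continuous_const
  | t + 1, (c, z), s' => by
    have hρ : Continuous fun e => ρ e t c :=
      (continuous_apply _).comp ((continuous_apply _).comp h)
    refine continuous_finsetSum _ fun s _ => continuous_finsetSum _ fun u _ => ?_
    exact ((continuous_law h t c s).mul
      (G.continuous_actProb hρ.fst hρ.snd s.2 u)).mul continuous_const

theorem continuous_totalCost {E : Type} [TopologicalSpace E] {ρ : E → G.Rule}
    (h : Continuous ρ) : Continuous fun e => G.totalCost (ρ e) := by
  refine continuous_finsetSum _ fun t _ => continuous_finsetSum _ fun c _ => ?_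
  have hρ : Continuous fun e => ρ e t c :=
    (continuous_apply _).comp ((continuous_apply _).comp h)
  refine continuous_finsetSum _ fun s _ => continuous_finsetSum _ fun u _ => ?_
  exact (continuous_const.mul (G.continuous_law h t c s)).mul
    (G.continuous_actProb hρ.fst hρ.snd s.2 u)

theorem continuous_J : Continuous fun g : G.Strategy 0 × G.Strategy 1 => G.J g.1 g.2 := by
  refine G.continuous_totalCost ?_
  fun_prop

theorem exists_isGreatest_J (g₁ : G.Strategy 0) :
    ∃ g₂, IsGreatest (Set.range (G.J g₁)) (G.J g₁ g₂) := by
  obtain ⟨g₂, -, h⟩ := isCompact_univ.exists_isMaxOn Set.univ_nonempty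
    (G.continuous_J.comp (Continuous.prodMk_right g₁)).continuousOn
  exact ⟨g₂, Set.mem_range_self _, Set.forall_mem_range.2 fun g => h (Set.mem_univ g)⟩

/-- A supremum of continuous functions is lower semicontinuous, hence attains its minimum on the
compact space of strategies, a product of simplices. -/
theorem exists_isGreatest_upperValue :
    ∃ g₁, IsGreatest (Set.range (G.J g₁)) G.upperValue := by
  have hbdd (g₁ : G.Strategy 0) : BddAbove (Set.range fun g₂ => G.J g₁ g₂) :=
    G.bddAbove_range_totalCost _
  have hlsc : LowerSemicontinuous fun g₁ => ⨆ g₂, G.J g₁ g₂ :=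
    lowerSemicontinuous_ciSup hbdd fun g₂ =>
      (G.continuous_J.comp (Continuous.prodMk_left g₂)).lowerSemicontinuous
  obtain ⟨g₁, -, h⟩ := (hlsc.lowerSemicontinuousOn Set.univ).exists_isMinOn
    Set.univ_nonempty isCompact_univ
  have hval : G.upperValue = ⨆ g₂, G.J g₁ g₂ :=
    le_antisymm (ciInf_le (G.bddBelow_range_iSup_totalCost _) g₁)
      (le_ciInf fun g => h (Set.mem_univ g))
  obtain ⟨g₂, h₂⟩ := G.exists_isGreatest_J g₁
  refine ⟨g₁, ?_⟩
  rw [hval, show (⨆ g₂, G.J g₁ g₂) = G.J g₁ g₂ from h₂.csSup_eq]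
  exact h₂

end TeamGame

/-- If only virtual player 1 controls the common information belief, then the upper values of the
original game and of the expanded game coincide, and both are equal to the value of the min-max
dynamic program, whether it is run with a Bayesian belief update or with the given one-sided
update.  In the original game, all the maxima and the minimum in the upper value are attained. -/
theorem theorem4 (G : TeamGame) (F : G.OneSidedUpdate) (hF : G.OnlyFirstControls F)
    (D : G.Update) :
    G.upperValue = G.expandedUpperValue ∧
    G.expandedUpperValue = G.expectedUpperV (G.bayesUpdate D) ∧
    G.expandedUpperValue = G.expectedUpperV (fun t π γ₁ _ z => F t π γ₁ z) ∧
    (∀ g₁ : G.Strategy 0, ∃ g₂ : G.Strategy 1, IsGreatest (Set.range (G.J g₁)) (G.J g₁ g₂)) ∧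
    (∃ g₁ : G.Strategy 0, IsGreatest (Set.range (G.J g₁)) G.upperValue) := by

  have h₁ : ∀ χ₁ χ₂, G.Tracks (G.bayesUpdate D) (G.play χ₁ χ₂) := fun _ _ =>
    G.tracks_bayesUpdate D _
  -- `OnlyFirstControls` is by definition the tracking property of the one-sided update along all
  -- plays.
  have h₂ : ∀ χ₁ χ₂, G.Tracks (fun t π γ₁ _ z => F t π γ₁ z) (G.play χ₁ χ₂) := hF
  have hv := G.expandedUpperValue_le_upperValue
  refine ⟨hv.antisymm' ?_, ?_, ?_, G.exists_isGreatest_J, G.exists_isGreatest_upperValue⟩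
  · exact (G.upperValue_le_expectedUpperV hF h₁).trans (G.expectedUpperV_le_expandedUpperValue h₁)
  · exact (hv.trans (G.upperValue_le_expectedUpperV hF h₁)).antisymm
      (G.expectedUpperV_le_expandedUpperValue h₁)
  · exact (hv.trans (G.upperValue_le_expectedUpperV hF h₂)).antisymm
      (G.expectedUpperV_le_expandedUpperValue h₂)
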